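/- Let $\mathbb{T}^2=\mathbb{R}^2/\mathbb{Z}^2$, let $A=\begin{pmatrix}2&1\\1&1\end{pmatrix}$ act linearly on $\mathbb{T}^2$, and let $W=\mathbb{T}^2\times[0,1]/(p,1)\sim(Ap,0)$ be the mapping torus of $A$, oriented as a quotient of its universal covering $\mathbb{R}^3$. Let $\mathrm{Mod}(W)$ be the group, under composition, of the isotopy classes of self-homeomorphisms of $W$, and let $\mathrm{Mod}^+(W)$ be its subgroup of the classes of orientation-preserving homeomorphisms. Put $$B_1=\begin{pmatrix}-1&0\\1&1\end{pmatrix},\qquad B_2=\begin{pmatrix}-1&0\\0&-1\end{pmatrix},\qquad B_3=\begin{pmatrix}1&0\\-1&-1\end{pmatrix}.$$ The homeomorphisms $g_0,g_1,g_2,g_3$ of $W$ given by $$g_0=\mathrm{id}_W,\quad g_1(p,t)=(B_1p,1-t),\quad g_2(p,t)=(B_2p,t),\quad g_3(p,t)=(B_3p,1-t)$$ are well defined. **Lemma 3.1.** The set of isotopy classes $\mathcal{G}=\{[g_0],[g_1],[g_2],[g_3]\}$ is a subgroup of $\mathrm{Mod}^+(W)$ that is isomorphic to $\mathbb{Z}_2\oplus\mathbb{Z}_2$.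 -/

import Mathlib

open CategoryTheory

noncomputable section

namespace SolManifold

/-! ### The torus and the sol-manifold -/

/-- The torus `ℝ² / ℤ²`. -/
abbrev Torus : Type := Fin 2 → UnitAddCircle

/-- The linear self-map of the torus given by an integer matrix. -/
def torusMap (B : Matrix (Fin 2) (Fin 2) ℤ) (x : Torus) : Torus :=
  fun i => ∑ j, B i j • x j

theorem continuous_torusMap (B : Matrix (Fin 2) (Fin 2) ℤ) : Continuous (torusMap B) := by
  unfold torusMap
  exact continuous_pi fun i => continuous_finsetSum _ fun j _ => (continuous_apply j).zsmul (B i j)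

theorem torusMap_one (x : Torus) : torusMap 1 x = x := by
  funext i
  simp [torusMap, Matrix.one_apply, ite_smul]

theorem torusMap_torusMap (B C : Matrix (Fin 2) (Fin 2) ℤ) (x : Torus) :
    torusMap B (torusMap C x) = torusMap (B * C) x := by
  funext i
  simp only [torusMap, Matrix.mul_apply, Fin.sum_univ_two, smul_add, add_smul, mul_smul]
  abel

/-- The matrix of the Anosov automorphism (the cat map). -/
def A : Matrix (Fin 2) (Fin 2) ℤ := !![2, 1; 1, 1]

def B₁ : Matrix (Fin 2) (Fin 2) ℤ := !![-1, 0; 1, 1]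

def B₂ : Matrix (Fin 2) (Fin 2) ℤ := !![-1, 0; 0, -1]

def B₃ : Matrix (Fin 2) (Fin 2) ℤ := !![1, 0; -1, -1]

/-- The gluing `(x, 1) ∼ (A x, 0)` on `𝕋² × [0, 1]`. -/
inductive Glue : Torus × unitInterval → Torus × unitInterval → Prop
  | glue (x : Torus) : Glue (x, 1) (torusMap A x, 0)

/-- The sol-manifold `W = 𝕋² × [0, 1] / (x, 1) ∼ (A x, 0)`, with the quotient topology. -/
def W : Type := Quot Glue

instance : TopologicalSpace W := inferInstanceAs (TopologicalSpace (Quot Glue))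

/-- The class in `W` of a point of `𝕋² × [0, 1]`. -/
def W.mk (x : Torus) (t : unitInterval) : W := Quot.mk Glue (x, t)

theorem W.glue (x : Torus) : W.mk x 1 = W.mk (torusMap A x) 0 := Quot.sound (Glue.glue x)

/-! ### The linear homeomorphisms of `W` -/

/-- `(x, t) ↦ (B x, t)`, well defined on `W` when `B` commutes with `A`. -/
def fiberMap (B : Matrix (Fin 2) (Fin 2) ℤ) (h : B * A = A * B) : W → W :=
  Quot.lift (fun p => W.mk (torusMap B p.1) p.2) (by
    rintro _ _ ⟨x⟩
    simp only [W.glue, torusMap_torusMap, h])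

/-- `(x, t) ↦ (B x, 1 - t)`, well defined on `W` when `B` conjugates `A` to its inverse. -/
def flipMap (B : Matrix (Fin 2) (Fin 2) ℤ) (h : A * (B * A) = B) : W → W :=
  Quot.lift (fun p => W.mk (torusMap B p.1) (unitInterval.symm p.2)) (by
    rintro _ _ ⟨x⟩
    simp only [unitInterval.symm_zero, unitInterval.symm_one, W.glue, torusMap_torusMap, h])

theorem continuous_fiberMap (B : Matrix (Fin 2) (Fin 2) ℤ) (h : B * A = A * B) :
    Continuous (fiberMap B h) :=
  continuous_quot_lift _ (continuous_quot_mk.comp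
    (((continuous_torusMap B).comp continuous_fst).prodMk continuous_snd))

theorem continuous_flipMap (B : Matrix (Fin 2) (Fin 2) ℤ) (h : A * (B * A) = B) :
    Continuous (flipMap B h) :=
  continuous_quot_lift _ (continuous_quot_mk.comp
    (((continuous_torusMap B).comp continuous_fst).prodMk
      (unitInterval.continuous_symm.comp continuous_snd)))

theorem fiberMap_fiberMap (B : Matrix (Fin 2) (Fin 2) ℤ) (h : B * A = A * B) (h2 : B * B = 1)
    (w : W) : fiberMap B h (fiberMap B h w) = w := by
  obtain ⟨⟨x, t⟩, rfl⟩ := Quot.exists_rep w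
  change W.mk (torusMap B (torusMap B x)) t = W.mk x t
  rw [torusMap_torusMap, h2, torusMap_one]

theorem flipMap_flipMap (B : Matrix (Fin 2) (Fin 2) ℤ) (h : A * (B * A) = B) (h2 : B * B = 1)
    (w : W) : flipMap B h (flipMap B h w) = w := by
  obtain ⟨⟨x, t⟩, rfl⟩ := Quot.exists_rep w
  change W.mk (torusMap B (torusMap B x)) (unitInterval.symm (unitInterval.symm t)) = W.mk x t
  rw [torusMap_torusMap, h2, torusMap_one, unitInterval.symm_symm]

/-- The homeomorphism `(x, t) ↦ (B x, t)` of `W`. -/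
def fiberHomeo (B : Matrix (Fin 2) (Fin 2) ℤ) (h : B * A = A * B) (h2 : B * B = 1) : W ≃ₜ W where
  toFun := fiberMap B h
  invFun := fiberMap B h
  left_inv := fiberMap_fiberMap B h h2
  right_inv := fiberMap_fiberMap B h h2
  continuous_toFun := continuous_fiberMap B h
  continuous_invFun := continuous_fiberMap B h

/-- The homeomorphism `(x, t) ↦ (B x, 1 - t)` of `W`. -/
def flipHomeo (B : Matrix (Fin 2) (Fin 2) ℤ) (h : A * (B * A) = B) (h2 : B * B = 1) : W ≃ₜ W where
  toFun := flipMap B h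
  invFun := flipMap B h
  left_inv := flipMap_flipMap B h h2
  right_inv := flipMap_flipMap B h h2
  continuous_toFun := continuous_flipMap B h
  continuous_invFun := continuous_flipMap B h

/-- `g₀` is the identity. -/
def g₀ : W ≃ₜ W := Homeomorph.refl W

/-- `g₁ (x, t) = (B₁ x, 1 - t)`. -/
def g₁ : W ≃ₜ W := flipHomeo B₁ (by decide) (by decide)

/-- `g₂ (x, t) = (B₂ x, t)`. -/
def g₂ : W ≃ₜ W := fiberHomeo B₂ (by decide) (by decide)

/-- `g₃ (x, t) = (B₃ x, 1 - t)`. -/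
def g₃ : W ≃ₜ W := flipHomeo B₃ (by decide) (by decide)

/-! ### Isotopy and the mapping class group -/

section MappingClassGroup

variable {X : Type} [TopologicalSpace X]

/-- Two self-homeomorphisms are isotopic if they are the ends of a continuous family, indexed by
`[0, 1]`, of self-homeomorphisms. -/
def Isotopic (f g : X ≃ₜ X) : Prop :=
  ∃ h : unitInterval → (X ≃ₜ X),
    Continuous (fun p : unitInterval × X => h p.1 p.2) ∧ h 0 = f ∧ h 1 = g

theorem Isotopic.mul_left {f g : X ≃ₜ X} (k : X ≃ₜ X) (H : Isotopic f g) :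
    Isotopic (k * f) (k * g) := by
  obtain ⟨h, hc, h0, h1⟩ := H
  exact ⟨fun t => k * h t, k.continuous.comp hc, by simp only [h0], by simp only [h1]⟩

theorem Isotopic.mul_right {f g : X ≃ₜ X} (k : X ≃ₜ X) (H : Isotopic f g) :
    Isotopic (f * k) (g * k) := by
  obtain ⟨h, hc, h0, h1⟩ := H
  exact ⟨fun t => h t * k,
    hc.comp (continuous_fst.prodMk (k.continuous.comp continuous_snd)), by simp only [h0], by simp only [h1]⟩

theorem Isotopic.symm {f g : X ≃ₜ X} (H : Isotopic f g) : Isotopic g f := by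
  obtain ⟨h, hc, h0, h1⟩ := H
  exact ⟨fun t => h (unitInterval.symm t),
    hc.comp ((unitInterval.continuous_symm.comp continuous_fst).prodMk continuous_snd),
    by simpa using h1, by simpa using h0⟩

variable (X) in
/-- The homeomorphisms isotopic to the identity form a normal subgroup of the group of
self-homeomorphisms (the group law is composition). -/
def isotopicToId : Subgroup (X ≃ₜ X) where
  carrier := {f | Isotopic f 1}
  one_mem' := ⟨fun _ => 1, continuous_snd, rfl, rfl⟩
  mul_mem' := by
    rintro f g ⟨h, hc, h0, h1⟩ ⟨k, kc, k0, k1⟩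
    exact ⟨fun t => h t * k t, hc.comp (continuous_fst.prodMk kc),
      by simp only [h0, k0], by simp only [h1, k1, one_mul]⟩
  inv_mem' := by
    intro f H
    have := (Isotopic.mul_left f⁻¹ H).symm
    rwa [inv_mul_cancel, mul_one] at this

instance : (isotopicToId X).Normal where
  conj_mem f H g := by
    have := (Isotopic.mul_left g H).mul_right g⁻¹
    rwa [mul_one, mul_inv_cancel] at this

variable (X) in
/-- The mapping class group: the self-homeomorphisms up to isotopy, under composition. -/
abbrev MappingClassGroup : Type := (X ≃ₜ X) ⧸ isotopicToId X

/-- The isotopy class of a self-homeomorphism. -/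
def isotopyClass (f : X ≃ₜ X) : MappingClassGroup X := QuotientGroup.mk f

theorem isotopyClass_eq_iff (f g : X ≃ₜ X) : isotopyClass f = isotopyClass g ↔ Isotopic f g := by
  refine QuotientGroup.eq.trans ⟨fun H => ?_, fun H => ?_⟩
  · have := (Isotopic.mul_left f H).symm
    rwa [mul_one, mul_inv_cancel_left] at this
  · have := (Isotopic.mul_left f⁻¹ H).symm
    rwa [inv_mul_cancel] at this

end MappingClassGroup

/-! ### Orientation-preserving homeomorphisms -/

/-- Three-dimensional space, with coordinates `((x, y), t)`. -/
abbrev Space : Type := (Fin 2 → ℝ) × ℝ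

/-- Three-dimensional space without the origin. -/
abbrev PuncturedSpace : Type := {v : Space // v ≠ 0}

/-- The homeomorphism `F` of `ℝ³` seen from `p`: the map `v ↦ F (p + v) - F p` of `ℝ³ ∖ {0}`. -/
def localMap (F : Space ≃ₜ Space) (p : Space) : C(PuncturedSpace, PuncturedSpace) where
  toFun v := ⟨F (p + v.1) - F p, fun h => v.2 (by simpa using F.injective (sub_eq_zero.1 h))⟩
  continuous_toFun := by fun_prop

/-- The map that a continuous self-map of `ℝ³ ∖ {0}` induces on the singular homology group
`H₂(ℝ³ ∖ {0}; ℤ) ≅ ℤ`. -/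
def homologyMap (u : C(PuncturedSpace, PuncturedSpace)) :=
  ((AlgebraicTopology.singularHomologyFunctor (ModuleCat.{0} ℤ) 2).obj (ModuleCat.of ℤ ℤ)).map
    (TopCat.ofHom u)

/-- A homeomorphism of `ℝ³` preserves the orientation if its local degree is `1` at every point `p`,
that is, if it induces the identity on `H₃(ℝ³, ℝ³ ∖ {0}) ≅ H₂(ℝ³ ∖ {0})` once `p` and its image are
translated to the origin. -/
def PreservesOrientation (F : Space ≃ₜ Space) : Prop :=
  ∀ p, homologyMap (localMap F p) = 𝟙 _

theorem homologyMap_comp (u v : C(PuncturedSpace, PuncturedSpace)) :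
    homologyMap (u.comp v) = homologyMap v ≫ homologyMap u := by
  rw [homologyMap, TopCat.ofHom_comp, Functor.map_comp]
  rfl

theorem homologyMap_id : homologyMap (ContinuousMap.id _) = 𝟙 _ := by
  rw [homologyMap, TopCat.ofHom_id, CategoryTheory.Functor.map_id]

theorem localMap_mul (F G : Space ≃ₜ Space) (p : Space) :
    localMap (F * G) p = (localMap F (G p)).comp (localMap G p) := by
  ext1 v
  apply Subtype.ext
  simp [localMap]

theorem localMap_one (p : Space) : localMap 1 p = ContinuousMap.id _ := by
  ext1 v
  apply Subtype.ext
  simp [localMap]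

theorem PreservesOrientation.one : PreservesOrientation 1 := fun p => by
  rw [localMap_one, homologyMap_id]

theorem PreservesOrientation.mul {F G : Space ≃ₜ Space} (hF : PreservesOrientation F)
    (hG : PreservesOrientation G) : PreservesOrientation (F * G) := fun p => by
  rw [localMap_mul, homologyMap_comp, hF, hG, Category.comp_id]

theorem PreservesOrientation.inv {F : Space ≃ₜ Space} (hF : PreservesOrientation F) :
    PreservesOrientation F⁻¹ := fun p => by
  have h := localMap_mul F F⁻¹ p
  rw [mul_inv_cancel, localMap_one] at h
  have h' := homologyMap_comp (localMap F (F⁻¹ p)) (localMap F⁻¹ p)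
  rw [← h, homologyMap_id, hF, Category.comp_id] at h'
  exact h'.symm

/-- The universal covering `ℝ³ → W`. It restricts to `(v, t) ↦ [(v mod ℤ², t)]` on `ℝ² × [0, 1]`, and
its deck transformations are generated by the translations by `ℤ²` and by
`(v, t) ↦ (A⁻¹ v, t + 1)`. -/
def cover (p : Space) : W :=
  W.mk (fun i => ((((((A ^ ⌊p.2⌋).map (Int.cast : ℤ → ℝ)).mulVec p.1) i : ℝ)) : UnitAddCircle))
    ⟨Int.fract p.2, Int.fract_nonneg _, (Int.fract_lt_one _).le⟩

/-- A homeomorphism of `W` preserves the orientation if it has a lift to the universal covering `ℝ³`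
that preserves the orientation. The deck transformations of `ℝ³ → W` preserve the orientation of
`ℝ³`, so that `W` inherits an orientation, and the choice of the lift does not matter. -/
def IsOrientationPreserving (f : W ≃ₜ W) : Prop :=
  ∃ F : Space ≃ₜ Space, (∀ p, cover (F p) = f (cover p)) ∧ PreservesOrientation F

/-- The group of the orientation-preserving homeomorphisms of `W`. -/
def homeoPlus : Subgroup (W ≃ₜ W) where
  carrier := {f | IsOrientationPreserving f}
  one_mem' := ⟨1, fun _ => rfl, PreservesOrientation.one⟩
  mul_mem' := by
    rintro f g ⟨F, hF, oF⟩ ⟨G, hG, oG⟩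
    exact ⟨F * G, fun p => by simp [hF, hG], oF.mul oG⟩
  inv_mem' := by
    rintro f ⟨F, hF, oF⟩
    refine ⟨F⁻¹, fun p => f.injective ?_, oF.inv⟩
    rw [← hF]
    simp

/-- `Mod⁺(W)`: the subgroup of the classes of orientation-preserving homeomorphisms. -/
def modPlus : Subgroup (MappingClassGroup W) :=
  homeoPlus.map (QuotientGroup.mk' (isotopicToId W))

end SolManifold

end

/-!
The maps `g₁`, `g₂`, `g₃` are commuting involutions with `g₁ g₂ = g₃`, so two points carry the
proof: `g₁` and `g₂` preserve the orientation, and none of the three is isotopic to the identity.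

*Orientation.* The lifts of `g₁` and `g₂` to `ℝ³` have half-turns (in a suitable basis) as linear
parts. A half-turn is the square of a quarter turn, which has no negative eigenvalue and is
therefore joined to the identity by a segment of invertible linear maps. By homotopy invariance of
singular homology, a quarter turn induces the identity on `H₂(ℝ³ ∖ {0})`, whatever this group is
(`PreservesOrientation.of_affine`).

*Isotopy.* The projection `𝕋² × ℝ → W` is the covering by the action `(x, t) ↦ (A⁻ⁿ x, t + n)` of
`ℤ` (`isAddQuotientCoveringMap_proj`). An isotopy from the identity to `f` lifts to a homotopy from
the identity that commutes with this action, and whose end is a given lift of `f` up to a deck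
transformation (`Isotopic.exists_lift`). The lifts `(x, t) ↦ (B x, 1 - t)` of `g₁` and `g₃` do not
commute with the action, as they reverse `ℤ` (`not_isotopic_flipHomeo`). For `g₂`, the torus
automorphism `A⁻ᵏ B₂` would be homotopic to the identity for some `k`; comparing degrees on circles
gives `Aᵏ = B₂ = -1`, which is impossible as `Aⁿ` has nonnegative entries for `n ≥ 0`
(`not_isotopic_g₂`).
-/

noncomputable section

namespace SolManifold

/-! ### Quarter turns of `ℝ³` -/

theorem homologyMap_eq_of_homotopy {u v : C(PuncturedSpace, PuncturedSpace)}
    (H : u.Homotopy v) : homologyMap u = homologyMap v :=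
  TopCat.Homotopy.congr_homologyMap_singularChainComplexFunctor
    (f := TopCat.ofHom u) (g := TopCat.ofHom v) H _ _

/-- A homeomorphism with the increments `L` preserves the orientation if no map on the straight-line
homotopy from the identity to `L` takes a nonzero vector to `0`: the homotopy then stays in
`ℝ³ ∖ {0}`. -/
theorem PreservesOrientation.of_affine (F : Space ≃ₜ Space) (L : Space → Space)
    (hL : Continuous L) (hF : ∀ p v, F (p + v) - F p = L v)
    (h : ∀ s : unitInterval, ∀ v ≠ 0, (1 - s : ℝ) • v + (s : ℝ) • L v ≠ 0) :
    PreservesOrientation F := by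
  intro p
  rw [← homologyMap_id]
  refine (homologyMap_eq_of_homotopy ?_).symm
  exact
    { toFun := fun x => ⟨(1 - x.1 : ℝ) • x.2.1 + (x.1 : ℝ) • L x.2.1, h x.1 x.2.1 x.2.2⟩
      continuous_toFun := by fun_prop
      map_zero_left := fun x => Subtype.ext (by simp)
      map_one_left := fun x => Subtype.ext (by simp [localMap, hF]) }

/-- The quarter turn `(x, y, t) ↦ (-y, x, t)`, a square root of the lift of `g₂`. -/
def quarterTurn : Space ≃ₜ Space where
  toFun p := (![-p.1 1, p.1 0], p.2)
  invFun p := (![p.1 1, -p.1 0], p.2)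
  left_inv p := by ext i <;> [fin_cases i; skip] <;> simp
  right_inv p := by ext i <;> [fin_cases i; skip] <;> simp
  continuous_toFun := by fun_prop
  continuous_invFun := by fun_prop

/-- The rotation by a quarter turn about the fixed axis of `B₁ × (-1)`, in the basis of its
eigenvectors; a square root of the linear part of the lift of `g₁`. -/
def flipQuarterTurn : Space ≃ₜ Space where
  toFun p := (![2 * p.2, p.1 0 / 2 + p.1 1 - p.2], -p.1 0 / 2)
  invFun p := (![-2 * p.2, p.1 0 / 2 + p.1 1 + p.2], p.1 0 / 2)
  left_inv p := by ext i <;> [fin_cases i; skip] <;> simp <;> ring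
  right_inv p := by ext i <;> [fin_cases i; skip] <;> simp <;> ring
  continuous_toFun := by fun_prop
  continuous_invFun := by fun_prop

/-- The straight-line homotopy from the identity to a quarter turn of the plane never takes a
nonzero vector to `0`, as a quarter turn has no real eigenvalue. -/
theorem eq_zero_of_segment {s a b : ℝ} (h₁ : (1 - s) * a - s * b = 0)
    (h₂ : (1 - s) * b + s * a = 0) : a = 0 ∧ b = 0 := by
  have h : ((1 - s) ^ 2 + s ^ 2) * (a ^ 2 + b ^ 2) = 0 := by
    linear_combination ((1 - s) * a - s * b) * h₁ + ((1 - s) * b + s * a) * h₂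
  have : a ^ 2 + b ^ 2 = 0 := by
    rcases mul_eq_zero.1 h with h | h
    · nlinarith [sq_nonneg (2 * s - 1)]
    · exact h
  constructor <;> nlinarith [sq_nonneg a, sq_nonneg b]

theorem preservesOrientation_quarterTurn : PreservesOrientation quarterTurn := by
  refine .of_affine _ quarterTurn quarterTurn.continuous (fun p v => ?_) fun s v hv h => hv ?_
  · ext i <;> [fin_cases i; skip] <;> simp [quarterTurn]
  · have h0 := congrFun (congrArg Prod.fst h) 0
    have h1 := congrFun (congrArg Prod.fst h) 1
    have h2 := congrArg Prod.snd h
    simp [quarterTurn] at h0 h1 h2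
    obtain ⟨h0, h1⟩ := eq_zero_of_segment (s := s) (a := v.1 0) (b := v.1 1) (by linarith) h1
    ext i <;> [fin_cases i; skip]
    · exact h0
    · exact h1
    · simp only [Prod.snd_zero]; linarith

theorem preservesOrientation_flipQuarterTurn : PreservesOrientation flipQuarterTurn := by
  refine .of_affine _ flipQuarterTurn flipQuarterTurn.continuous (fun p v => ?_)
    fun s v hv h => hv ?_
  · ext i <;> [fin_cases i; skip] <;> simp [flipQuarterTurn] <;> ring
  · have h0 := congrFun (congrArg Prod.fst h) 0
    have h1 := congrFun (congrArg Prod.fst h) 1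
    have h2 := congrArg Prod.snd h
    simp [flipQuarterTurn] at h0 h1 h2
    obtain ⟨h0, h2⟩ := eq_zero_of_segment (s := s) (a := -v.1 0 / 2) (b := v.2)
      (by linear_combination -h0 / 2) (by linear_combination h2)
    have h0 : v.1 0 = 0 := by linarith
    simp only [h0, h2] at h1
    ext i <;> [fin_cases i; skip]
    · exact h0
    · simp only [Fin.mk_one, Prod.fst_zero, Pi.zero_apply]; linarith
    · exact h2

theorem preservesOrientation_addLeft (c : Space) : PreservesOrientation (Homeomorph.addLeft c) := by
  refine .of_affine _ id continuous_id (fun p v => ?_) fun s v hv h => hv ?_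
  · simp
  · rwa [id, ← add_smul, sub_add_cancel, one_smul] at h

/-! ### The infinite cyclic covering of `W` -/

theorem isUnit_det_A : IsUnit A.det := by
  rw [show A.det = 1 by decide]
  exact isUnit_one

/-- The infinite cyclic covering space `𝕋² × ℝ` of `W`. -/
abbrev CyclicCover : Type := Torus × ℝ

namespace CyclicCover

/-- The deck transformations `(x, t) ↦ (A⁻ⁿ x, t + n)`. -/
instance : AddAction ℤ CyclicCover where
  vadd n e := (torusMap (A ^ (-n)) e.1, e.2 + n)
  zero_vadd e := Prod.ext (by simp [HVAdd.hVAdd, torusMap_one]) (by simp [HVAdd.hVAdd])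
  add_vadd m n e := Prod.ext
    (by simp only [HVAdd.hVAdd, torusMap_torusMap, ← Matrix.zpow_add isUnit_det_A, neg_add])
    (by simp only [HVAdd.hVAdd, Int.cast_add]; ring)

theorem vadd_def (n : ℤ) (e : CyclicCover) :
    n +ᵥ e = (torusMap (A ^ (-n)) e.1, e.2 + n) := rfl

theorem snd_vadd (n : ℤ) (e : CyclicCover) : (n +ᵥ e).2 = e.2 + n := rfl

instance : ContinuousConstVAdd ℤ CyclicCover where
  continuous_const_vadd _ :=
    ((continuous_torusMap _).comp continuous_fst).prodMk (continuous_snd.add continuous_const)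

instance : IsCancelVAdd ℤ CyclicCover where
  left_cancel' n _ _ h := by simpa using congrArg (-n +ᵥ ·) h
  right_cancel' _ _ _ h := by
    have := congrArg Prod.snd h
    simpa [snd_vadd] using this

instance : ProperlyDiscontinuousVAdd ℤ CyclicCover where
  finite_disjoint_inter_image {K L} hK hL := by
    obtain ⟨a, ha⟩ := (hK.image continuous_snd).isBounded.subset_closedBall 0
    obtain ⟨b, hb⟩ := (hL.image continuous_snd).isBounded.subset_closedBall 0
    refine (Set.finite_Icc (-⌈a + b⌉) ⌈a + b⌉).subset ?_
    rintro n ⟨_, ⟨e, he, rfl⟩, he'⟩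
    have h1 : |e.2| ≤ a := by simpa using ha ⟨e, he, rfl⟩
    have h2 : |e.2 + n| ≤ b := by simpa [snd_vadd] using hb ⟨_, he', rfl⟩
    rw [abs_le] at h1 h2
    have h3 := Int.le_ceil (a + b)
    constructor
    · have : -(⌈a + b⌉ : ℝ) ≤ n := by linarith
      exact_mod_cast this
    · have : (n : ℝ) ≤ ⌈a + b⌉ := by linarith
      exact_mod_cast this

/-- The covering map `𝕋² × ℝ → W`. -/
def proj (e : CyclicCover) : W :=
  W.mk (torusMap (A ^ ⌊e.2⌋) e.1) ⟨Int.fract e.2, Int.fract_nonneg _, (Int.fract_lt_one _).le⟩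

theorem proj_vadd (n : ℤ) (e : CyclicCover) : proj (n +ᵥ e) = proj e := by
  simp only [proj, vadd_def, torusMap_torusMap, Int.floor_add_intCast, Int.fract_add_intCast,
    ← Matrix.zpow_add isUnit_det_A, add_neg_cancel_right]

/-- On `𝕋² × [0, 1]` the covering map is the quotient map. At the end `t = 1`, where `⌊t⌋ = 1`, this
is the gluing. -/
theorem proj_mk (x : Torus) (t : unitInterval) :
    proj ((x, (t : ℝ)) : CyclicCover) = W.mk x t := by
  rcases t.2.2.lt_or_eq with h | h
  · have h0 : ⌊(t : ℝ)⌋ = 0 := Int.floor_eq_zero_iff.2 ⟨t.2.1, h⟩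
    have h1 : Int.fract (t : ℝ) = t := Int.fract_eq_self.2 ⟨t.2.1, h⟩
    simp only [proj, h0, h1, zpow_zero, torusMap_one]
  · obtain rfl : t = 1 := Subtype.ext h
    simp [proj, W.glue]

/-- Every point of `𝕋² × ℝ` has a translate in `𝕋² × [0, 1]`. -/
theorem exists_eq_vadd (e : CyclicCover) :
    ∃ (n : ℤ) (x : Torus) (t : unitInterval), e = n +ᵥ ((x, (t : ℝ)) : CyclicCover) :=
  ⟨⌊e.2⌋, torusMap (A ^ ⌊e.2⌋) e.1, ⟨Int.fract e.2, Int.fract_nonneg _, (Int.fract_lt_one _).le⟩,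
    Prod.ext (by simp [vadd_def, torusMap_torusMap, ← Matrix.zpow_add isUnit_det_A, torusMap_one])
      (by simp [vadd_def])⟩

end CyclicCover

open CyclicCover

instance : CompactSpace W := inferInstanceAs (CompactSpace (Quot Glue))

/-- The bijection between `W` and the orbit space of the deck transformations. -/
def orbitEquiv : W ≃ Quotient (AddAction.orbitRel ℤ CyclicCover) where
  toFun := Quot.lift (fun p => Quotient.mk _ ((p.1, (p.2 : ℝ)) : CyclicCover)) (by
    rintro _ _ ⟨x⟩
    refine Quotient.sound ⟨1, Prod.ext ?_ ?_⟩
    · change torusMap (A ^ (-1 : ℤ)) (torusMap A x) = x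
      rw [torusMap_torusMap, Matrix.zpow_neg_one, Matrix.nonsing_inv_mul _ isUnit_det_A,
        torusMap_one]
    · simp [snd_vadd])
  invFun := Quotient.lift proj (by
    rintro _ e ⟨n, rfl⟩
    exact proj_vadd n e)
  left_inv w := by
    obtain ⟨⟨x, t⟩, rfl⟩ := Quot.exists_rep w
    exact proj_mk x t
  right_inv z := by
    induction z using Quotient.inductionOn with | _ e
    obtain ⟨n, x, t, rfl⟩ := exists_eq_vadd e
    simp only [Quotient.lift_mk, proj_vadd, proj_mk]
    exact Quotient.sound ((AddAction.orbitRel ℤ CyclicCover).symm ⟨n, rfl⟩)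

theorem continuous_orbitEquiv : Continuous orbitEquiv :=
  continuous_quot_lift _ (continuous_quotient_mk'.comp
    (continuous_fst.prodMk (continuous_subtype_val.comp continuous_snd)))

/-- The orbit space is Hausdorff and `W` is compact, so that the continuous bijection between them
is a homeomorphism, and `proj` is the orbit map. -/
theorem isAddQuotientCoveringMap_proj : IsAddQuotientCoveringMap proj ℤ :=
  (isAddQuotientCoveringMap_quotientMk_of_properlyDiscontinuousVAdd
    (E := CyclicCover) (G := ℤ)).homeomorph_comp
    (Continuous.homeoOfEquivCompactToT2 continuous_orbitEquiv).symm

theorem isCoveringMap_proj : IsCoveringMap proj := isAddQuotientCoveringMap_proj.isCoveringMap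

/-- The lift `(x, t) ↦ (B x, t)` of `fiberMap B`. -/
def fiberLift (B : Matrix (Fin 2) (Fin 2) ℤ) (e : CyclicCover) : CyclicCover :=
  (torusMap B e.1, e.2)

/-- The lift `(x, t) ↦ (B x, 1 - t)` of `flipMap B`. -/
def flipLift (B : Matrix (Fin 2) (Fin 2) ℤ) (e : CyclicCover) : CyclicCover :=
  (torusMap B e.1, 1 - e.2)

theorem continuous_fiberLift (B : Matrix (Fin 2) (Fin 2) ℤ) : Continuous (fiberLift B) :=
  ((continuous_torusMap B).comp continuous_fst).prodMk continuous_snd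

theorem continuous_flipLift (B : Matrix (Fin 2) (Fin 2) ℤ) : Continuous (flipLift B) :=
  ((continuous_torusMap B).comp continuous_fst).prodMk (continuous_const.sub continuous_snd)

theorem fiberLift_vadd {B : Matrix (Fin 2) (Fin 2) ℤ} (h : B * A = A * B) (n : ℤ)
    (e : CyclicCover) : fiberLift B (n +ᵥ e) = n +ᵥ fiberLift B e := by
  have hB : B * A ^ (-n) = A ^ (-n) * B :=
    Matrix.SemiconjBy.zpow_right isUnit_det_A isUnit_det_A h (-n)
  simp only [fiberLift, vadd_def, torusMap_torusMap, hB]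

theorem flipLift_vadd {B : Matrix (Fin 2) (Fin 2) ℤ} (h : A * (B * A) = B) (n : ℤ)
    (e : CyclicCover) : flipLift B (n +ᵥ e) = -n +ᵥ flipLift B e := by
  have h' : SemiconjBy B A A⁻¹ := by
    rw [SemiconjBy]
    nth_rw 2 [← h]
    rw [← mul_assoc, Matrix.nonsing_inv_mul _ isUnit_det_A, one_mul]
  have hB : B * A ^ (-n) = A⁻¹ ^ (-n) * B :=
    Matrix.SemiconjBy.zpow_right isUnit_det_A (Matrix.isUnit_nonsing_inv_det _ isUnit_det_A) h' (-n)
  rw [Matrix.inv_zpow, ← Matrix.zpow_neg isUnit_det_A] at hB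
  simp only [flipLift, vadd_def, torusMap_torusMap, hB]
  congr 1
  push_cast
  ring

theorem proj_fiberLift {B : Matrix (Fin 2) (Fin 2) ℤ} (h : B * A = A * B) (e : CyclicCover) :
    proj (fiberLift B e) = fiberMap B h (proj e) := by
  obtain ⟨n, x, t, rfl⟩ := exists_eq_vadd e
  rw [fiberLift_vadd h, proj_vadd, proj_vadd, proj_mk]
  exact proj_mk _ t

theorem proj_flipLift {B : Matrix (Fin 2) (Fin 2) ℤ} (h : A * (B * A) = B) (e : CyclicCover) :
    proj (flipLift B e) = flipMap B h (proj e) := by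
  obtain ⟨n, x, t, rfl⟩ := exists_eq_vadd e
  rw [flipLift_vadd h, proj_vadd, proj_vadd, proj_mk]
  exact proj_mk _ (unitInterval.symm t)

theorem coe_mulVec (B : Matrix (Fin 2) (Fin 2) ℤ) (v : Fin 2 → ℝ) :
    (fun i => (((B.map (Int.cast : ℤ → ℝ)).mulVec v i : ℝ) : UnitAddCircle)) =
      torusMap B fun i => (v i : UnitAddCircle) := by
  funext i
  simp [torusMap, Matrix.mulVec, dotProduct, Fin.sum_univ_two, ← zsmul_eq_mul]

/-- The universal covering `ℝ³ → W` factors through the cyclic covering. -/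
theorem cover_eq_proj (p : Space) :
    cover p = proj ((fun i => (p.1 i : UnitAddCircle), p.2) : CyclicCover) := by
  simp only [cover, proj, coe_mulVec]

/-! ### The orientation -/

/-- A lift of `g₁` is `(v, t) ↦ (B₁ v, 1 - t)`. -/
theorem isOrientationPreserving_g₁ : IsOrientationPreserving g₁ := by
  refine ⟨Homeomorph.addLeft ((0, 1) : Space) * (flipQuarterTurn * flipQuarterTurn), fun p => ?_,
    (preservesOrientation_addLeft _).mul
      (preservesOrientation_flipQuarterTurn.mul preservesOrientation_flipQuarterTurn)⟩
  rw [cover_eq_proj, cover_eq_proj]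
  refine Eq.trans ?_ (proj_flipLift (B := B₁) (by decide) _)
  rw [flipLift, ← coe_mulVec]
  congr 1
  refine Prod.ext (funext fun i => congrArg (fun r : ℝ => (r : UnitAddCircle)) ?_) ?_
  · fin_cases i <;>
      simp [flipQuarterTurn, B₁, Matrix.mulVec, dotProduct, Fin.sum_univ_two] <;> ring
  · simp [flipQuarterTurn]; ring

/-- A lift of `g₂` is `(v, t) ↦ (-v, t)`. -/
theorem isOrientationPreserving_g₂ : IsOrientationPreserving g₂ := by
  refine ⟨quarterTurn * quarterTurn, fun p => ?_,
    preservesOrientation_quarterTurn.mul preservesOrientation_quarterTurn⟩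
  rw [cover_eq_proj, cover_eq_proj]
  refine Eq.trans ?_ (proj_fiberLift (B := B₂) (by decide) _)
  rw [fiberLift, ← coe_mulVec]
  congr 1
  refine Prod.ext (funext fun i => congrArg (fun r : ℝ => (r : UnitAddCircle)) ?_) ?_
  · fin_cases i <;>
      simp [quarterTurn, B₂, Matrix.mulVec, dotProduct, Fin.sum_univ_two]
  · simp [quarterTurn]

/-! ### Isotopies lifted to the cyclic covering -/

/-- An isotopy from the identity to `f` lifts to the cyclic covering, as a homotopy `Φ` from the
identity that commutes with the deck transformations. Its end agrees with any given lift of `f` up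
to a deck transformation. -/
theorem Isotopic.exists_lift {f : W ≃ₜ W} (H : Isotopic 1 f) {G : CyclicCover → CyclicCover}
    (hG : Continuous G) (hGf : ∀ e, proj (G e) = f (proj e)) :
    ∃ (k : ℤ) (Φ : C(unitInterval × CyclicCover, CyclicCover)),
      (∀ e, Φ (0, e) = e) ∧ (∀ e, Φ (1, e) = k +ᵥ G e) ∧
        ∀ s (n : ℤ) e, Φ (s, n +ᵥ e) = n +ᵥ Φ (s, e) := by
  obtain ⟨h, hc, h0, rfl⟩ := H
  have hp : Continuous proj := isCoveringMap_proj.continuous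
  let K : C(unitInterval × CyclicCover, W) := ⟨fun x => h x.1 (proj x.2), by fun_prop⟩
  have K0 : ∀ e, K (0, e) = proj (ContinuousMap.id CyclicCover e) := fun e => by simp [K, h0]
  let Φ := isCoveringMap_proj.liftHomotopy K (.id _) K0
  have hΦ : ∀ s e, proj (Φ (s, e)) = h s (proj e) := fun s e =>
    congrFun (isCoveringMap_proj.liftHomotopy_lifts K (.id _) K0) (s, e)
  have Φ0 : ∀ e, Φ (0, e) = e := isCoveringMap_proj.liftHomotopy_zero K (.id _) K0
  let e₀ : CyclicCover := (0, 0)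
  obtain ⟨k, hk⟩ := isAddQuotientCoveringMap_proj.apply_eq_iff_mem_orbit.1
    ((hΦ 1 e₀).trans (hGf e₀).symm)
  refine ⟨k, Φ, Φ0, fun e => ?_, fun s n e => ?_⟩
  · refine congrFun (isCoveringMap_proj.eq_of_comp_eq (g₁ := fun e => Φ (1, e))
      (g₂ := fun e => k +ᵥ G e) (by fun_prop) (hG.const_vadd k) (funext fun e => ?_) e₀ hk.symm) e
    simp only [Function.comp, hΦ, proj_vadd, hGf]
  · refine congrFun (isCoveringMap_proj.eq_of_comp_eq (g₁ := fun s => Φ (s, n +ᵥ e))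
      (g₂ := fun s => n +ᵥ Φ (s, e)) (by fun_prop) ?_ (funext fun s => ?_) 0 ?_) s
    · exact Continuous.const_vadd (by fun_prop) n
    · simp only [Function.comp, hΦ, proj_vadd]
    · simp only [Φ0]

/-- A flip reverses the action of the deck transformations, so it cannot be isotopic to the
identity. -/
theorem not_isotopic_flipHomeo (B : Matrix (Fin 2) (Fin 2) ℤ) (h : A * (B * A) = B)
    (h2 : B * B = 1) : ¬ Isotopic 1 (flipHomeo B h h2) := by
  intro H
  obtain ⟨k, Φ, -, Φ1, Φv⟩ := H.exists_lift (continuous_flipLift B) (proj_flipLift h)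
  -- The end of the lift takes `t` to `1 - t + k`, but `t + 1` has to go to the image of `t` plus `1`.
  have := congrArg Prod.snd (Φv 1 1 (0, 0))
  simp only [Φ1, flipLift_vadd h, snd_vadd] at this
  push_cast at this
  linarith

/-- Homotopic self-maps of the circle of degrees `m` and `n` have `m = n`. -/
theorem degree_eq_of_homotopy {m n : ℤ} {K : unitInterval × UnitAddCircle → UnitAddCircle}
    (hK : Continuous K) (K0 : ∀ u, K (0, u) = m • u) (K1 : ∀ u, K (1, u) = n • u) : m = n := by
  have cov : IsCoveringMap ((↑) : ℝ → UnitAddCircle) := AddCircle.isCoveringMap_coe 1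
  -- The difference with `m • u` starts at `0`, so it lifts to a real-valued function.
  let D : C(unitInterval × UnitAddCircle, UnitAddCircle) :=
    ⟨fun x => K x - m • x.2, hK.sub (continuous_snd.zsmul m)⟩
  have D0 : ∀ u, D (0, u) = ((ContinuousMap.const UnitAddCircle (0 : ℝ) u : ℝ) : UnitAddCircle) :=
    fun u => by simp [D, K0]
  let Ψ := cov.liftHomotopy D (.const _ 0) D0
  have hΨ : ∀ s u, (Ψ (s, u) : UnitAddCircle) = D (s, u) := fun s u =>
    congrFun (cov.liftHomotopy_lifts D (.const _ 0) D0) (s, u)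
  have key := cov.eq_of_comp_eq (g₁ := fun r : ℝ => Ψ (1, (r : UnitAddCircle)))
    (g₂ := fun r : ℝ => Ψ (1, ((0 : ℝ) : UnitAddCircle)) + (n - m) * r)
    (by fun_prop) (by fun_prop) (funext fun r => ?_) 0 (by simp)
  · have h1 := congrFun key 1
    have h2 : ((1 : ℝ) : UnitAddCircle) = ((0 : ℝ) : UnitAddCircle) := by
      rw [AddCircle.coe_period, AddCircle.coe_zero]
    simp only [h2] at h1
    have h3 : (m : ℝ) = n := by linarith
    exact_mod_cast h3
  · have h : (((n - m) * r : ℝ) : UnitAddCircle) =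
        n • (r : UnitAddCircle) - m • (r : UnitAddCircle) := by
      rw [sub_mul, AddCircle.coe_sub, ← zsmul_eq_mul, ← zsmul_eq_mul, AddCircle.coe_zsmul,
        AddCircle.coe_zsmul]
    simp only [Function.comp, AddCircle.coe_add, hΨ, h]
    simp [D, K1]

/-- A linear self-map of the torus that is homotopic to the identity is the identity. -/
theorem eq_one_of_homotopy {M : Matrix (Fin 2) (Fin 2) ℤ} {K : unitInterval × Torus → Torus}
    (hK : Continuous K) (K0 : ∀ x, K (0, x) = x) (K1 : ∀ x, K (1, x) = torusMap M x) : M = 1 := by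
  ext i j
  refine (degree_eq_of_homotopy
    (K := fun p => K (p.1, Pi.single j p.2) i) ?_ (fun u => ?_) fun u => ?_).symm
  · have : Continuous fun u : UnitAddCircle => (Pi.single j u : Torus) :=
      continuous_single (A := fun _ => UnitAddCircle) j
    fun_prop
  · by_cases h : i = j
    · subst h; simp [K0]
    · simp [K0, h]
  · simp [K1, torusMap, Pi.single_apply]

theorem A_pow_nonneg (n : ℕ) (i j : Fin 2) : 0 ≤ (A ^ n) i j := by
  induction n generalizing i j with
  | zero => fin_cases i <;> fin_cases j <;> simp
  | succ n ih =>
    rw [pow_succ, Matrix.mul_apply]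
    refine Finset.sum_nonneg fun k _ => mul_nonneg (ih i k) ?_
    fin_cases k <;> fin_cases j <;> decide

/-- No power of `A` is `-1`: the powers with exponent `n ≥ 0` have entries `≥ 0`, and `A⁻ⁿ = -1`
amounts to `Aⁿ = -1`. -/
theorem A_zpow_ne_B₂ (k : ℤ) : A ^ k ≠ B₂ := by
  have key : ∀ n : ℕ, A ^ n ≠ B₂ := fun n h => by
    have := A_pow_nonneg n 0 0
    rw [h] at this
    exact absurd this (by decide)
  obtain ⟨n, rfl | rfl⟩ := k.eq_nat_or_neg
  · rw [zpow_natCast]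
    exact key n
  · intro h
    refine key n ?_
    have h1 := Matrix.zpow_neg_mul_zpow_self n isUnit_det_A
    rw [h, zpow_natCast] at h1
    calc A ^ n = (B₂ * B₂) * A ^ n := by rw [show B₂ * B₂ = 1 by decide, one_mul]
      _ = B₂ := by rw [mul_assoc, h1, mul_one]

/-- If `g₂` were isotopic to the identity, the fibre component of the lifted isotopy, restricted to
`𝕋² × {0}`, would be a homotopy from the identity to `A⁻ᵏ B₂` for some `k`. -/
theorem not_isotopic_g₂ : ¬ Isotopic 1 g₂ := by
  intro H
  obtain ⟨k, Φ, Φ0, Φ1, -⟩ :=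
    H.exists_lift (continuous_fiberLift B₂) (proj_fiberLift (B := B₂) (by decide))
  have h : A ^ (-k) * B₂ = 1 := by
    refine eq_one_of_homotopy (K := fun p => (Φ (p.1, (p.2, 0))).1) (by fun_prop)
      (fun x => by rw [Φ0]) fun x => ?_
    rw [Φ1, vadd_def, fiberLift, torusMap_torusMap]
  refine A_zpow_ne_B₂ k ?_
  have h1 := congrArg (A ^ k * ·) h
  simpa [← mul_assoc, ← Matrix.zpow_add isUnit_det_A, eq_comm] using h1

/-! ### The group structure -/

theorem g₁_mul_g₂ : g₁ * g₂ = g₃ := by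
  ext w
  obtain ⟨⟨x, t⟩, rfl⟩ := Quot.exists_rep w
  change W.mk (torusMap B₁ (torusMap B₂ x)) _ = W.mk (torusMap B₃ x) _
  rw [torusMap_torusMap, show B₁ * B₂ = B₃ by decide]

theorem g₂_mul_g₁ : g₂ * g₁ = g₃ := by
  ext w
  obtain ⟨⟨x, t⟩, rfl⟩ := Quot.exists_rep w
  change W.mk (torusMap B₂ (torusMap B₁ x)) _ = W.mk (torusMap B₃ x) _
  rw [torusMap_torusMap, show B₂ * B₁ = B₃ by decide]

theorem g₁_mul_self : g₁ * g₁ = 1 :=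
  Homeomorph.ext (flipMap_flipMap B₁ (by decide) (by decide))

theorem g₂_mul_self : g₂ * g₂ = 1 :=
  Homeomorph.ext (fiberMap_fiberMap B₂ (by decide) (by decide))

/-- Two distinct commuting involutions generate a Klein four-group. -/
theorem exists_subgroup_klein_four {M : Type*} [Group M] {a b : M} (ha : a * a = 1) (hb : b * b = 1)
    (hab : a * b = b * a) (ha1 : a ≠ 1) (hb1 : b ≠ 1) (hab1 : a * b ≠ 1) :
    ∃ S : Subgroup M, (S : Set M) = {1, a, b, a * b} ∧
      Nonempty (S ≃* Multiplicative (ZMod 2 × ZMod 2)) := by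
  let S : Subgroup M :=
    { carrier := {1, a, b, a * b}
      one_mem' := by simp
      mul_mem' := by
        have h1 : a * (a * b) = b := by rw [← mul_assoc, ha, one_mul]
        have h2 : b * (a * b) = a := by rw [hab, ← mul_assoc, hb, one_mul]
        have h3 : a * b * a = b := by rw [mul_assoc, ← hab, h1]
        have h4 : a * b * b = a := by rw [mul_assoc, hb, mul_one]
        have h5 : a * b * (a * b) = 1 := by rw [mul_assoc, h2, ha]
        rintro x y (rfl | rfl | rfl | rfl) (rfl | rfl | rfl | rfl) <;>
          simp [ha, hb, h1, h2, h3, h4, h5, ← hab]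
      inv_mem' := by
        have h1 : a⁻¹ = a := inv_eq_of_mul_eq_one_left ha
        have h2 : b⁻¹ = b := inv_eq_of_mul_eq_one_left hb
        rintro x (rfl | rfl | rfl | rfl) <;> simp [h1, h2, ← hab] }
  refine ⟨S, rfl, ?_⟩
  have hne : a ≠ b := fun h => hab1 (by rw [← h, ha])
  have hcard : Nat.card S = 4 := by
    change Nat.card ({1, a, b, a * b} : Set M) = 4
    rw [Nat.card_coe_set_eq, Set.ncard_insert_of_notMem, Set.ncard_insert_of_notMem,
      Set.ncard_pair]
    · simpa using ha1
    · simp [hne, hb1]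
    · simp [ha1.symm, hb1.symm, hab1.symm]
  have : IsKleinFour S :=
    { card_four := hcard
      exponent_two := by
        have : Nontrivial S := ⟨⟨a, by simp [S]⟩, 1, fun h => ha1 (congrArg Subtype.val h)⟩
        rw [Monoid.exponent_eq_prime_iff Nat.prime_two]
        rintro ⟨x, hx⟩ hx1
        refine orderOf_eq_prime (Subtype.ext ?_) hx1
        rw [sq]
        rcases hx with rfl | rfl | rfl | rfl
        · exact mul_one 1
        · exact ha
        · exact hb
        · change a * b * (a * b) = 1
          rw [mul_assoc, ← mul_assoc b, ← hab, mul_assoc, hb, mul_one, ha] }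
  exact IsKleinFour.nonempty_mulEquiv

end SolManifold

end

open SolManifold in
theorem lemma3p1 :
    ∃ 𝒢 : Subgroup (MappingClassGroup W),
      𝒢 ≤ modPlus ∧
      (𝒢 : Set (MappingClassGroup W)) =
        {isotopyClass g₀, isotopyClass g₁, isotopyClass g₂, isotopyClass g₃} ∧
      Nonempty (𝒢 ≃* Multiplicative (ZMod 2 × ZMod 2)) := by
  have h3 : isotopyClass g₁ * isotopyClass g₂ = isotopyClass g₃ := congrArg isotopyClass g₁_mul_g₂
  have h3' : isotopyClass g₂ * isotopyClass g₁ = isotopyClass g₃ := congrArg isotopyClass g₂_mul_g₁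
  have hne : ∀ {f : W ≃ₜ W}, ¬ Isotopic 1 f → isotopyClass f ≠ 1 := fun hf h =>
    hf ((isotopyClass_eq_iff _ _).1 h.symm)
  obtain ⟨𝒢, h𝒢, hiso⟩ := exists_subgroup_klein_four (a := isotopyClass g₁) (b := isotopyClass g₂)
    (congrArg isotopyClass g₁_mul_self) (congrArg isotopyClass g₂_mul_self) (h3.trans h3'.symm)
    (hne (not_isotopic_flipHomeo _ _ _)) (hne not_isotopic_g₂)
    (h3 ▸ hne (not_isotopic_flipHomeo _ _ _))
  have m1 : isotopyClass g₁ ∈ modPlus := ⟨g₁, isOrientationPreserving_g₁, rfl⟩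
  have m2 : isotopyClass g₂ ∈ modPlus := ⟨g₂, isOrientationPreserving_g₂, rfl⟩
  refine ⟨𝒢, fun x hx => ?_, h𝒢.trans (by rw [h3]; rfl), hiso⟩
  rw [← SetLike.mem_coe, h𝒢] at hx
  rcases hx with rfl | rfl | rfl | rfl
  exacts [one_mem _, m1, m2, mul_mem m1 m2]
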